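/- Let $\mathbb D=\{z\in\mathbb C: |z|<1\}$ and let $H(\mathbb D)$ be the Fréchet space of all holomorphic functions on $\mathbb D$, equipped with the topology of uniform convergence on compact subsets of $\mathbb D$. For $t\in[0,1)$ let $C_t\colon H(\mathbb D)\to H(\mathbb D)$ be the continuous linear operator (the generalized Cesàro operator) given by $$C_tf(0)=f(0),\qquad C_tf(z)=\frac1z\int_0^z\frac{f(\xi)}{1-t\xi}\,d\xi\quad(z\in\mathbb D\setminus\{0\}).$$ For a continuous linear operator $T$ on a locally convex Hausdorff space $X$ over $\mathbb C$, the resolvent set $\rho(T;X)$ is the set of all $\lambda\in\mathbb C$ for which $\lambda I-T$ has an inverse $R(\lambda,T)=(\lambda I-T)^{-1}$ in the algebra $\mathcal L(X)$ of continuous linear operators on $X$; the spectrum is $\sigma(T;X)=\mathbb C\setminus\rho(T;X)$; the point spectrum $\sigma_{pt}(T;X)$ is the set of all $\lambda\in\mathbb C$ such that $\lambda I-T$ is not injective. Moreover, $\rho^*(T;X)$ is the set of all $\lambda\in\mathbb C$ for which there is $\delta>0$ such that the open disc $B(\lambda,\delta)$ is contained in $\rho(T;X)$ and $\{R(\mu,T):\mu\in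 B(\lambda,\delta)\}$ is an equicontinuous subset of $\mathcal L(X)$; the Waelbroeck spectrum is $\sigma^*(T;X)=\mathbb C\setminus\rho^*(T;X)$. **Proposition.** Let $\Lambda=\{\frac1{n+1}: n=0,1,2,\dots\}$. For each $t\in[0,1)$, $$\sigma_{pt}(C_t;H(\mathbb D))=\sigma(C_t;H(\mathbb D))=\Lambda\qquad\text{and}\qquad \sigma^*(C_t;H(\mathbb D))=\Lambda\cup\{0\}.$$ -/

import Mathlib

open Set Filter Topology Metric

/-! ### Spectra of continuous linear operators on topological vector spaces -/

section Spectra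

variable {X : Type*} [AddCommGroup X] [Module ℂ X] [TopologicalSpace X]

/-- The point spectrum of `T`: all `μ` such that `μ I - T` is not injective. -/
def pointSpectrum (T : X →L[ℂ] X) : Set ℂ :=
  {μ | ¬ Function.Injective (fun x : X => μ • x - T x)}

variable [IsTopologicalAddGroup X] [ContinuousConstSMul ℂ X]

/-- The set `ρ*(T)` of all `μ` having an open disc around them which lies in the resolvent set
of `T` in the algebra of continuous linear operators, and on which the resolvent operators
`(ν I - T)⁻¹` form an equicontinuous family. Equicontinuity refers to the canonical uniformity
of the topological vector space `X`. -/
def waelbroeckResolventSet (T : X →L[ℂ] X) : Set ℂ :=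
  letI : UniformSpace X := IsTopologicalAddGroup.rightUniformSpace X
  {μ | ∃ δ > (0 : ℝ), ball μ δ ⊆ resolventSet ℂ T ∧
    Equicontinuous (fun (ν : ball μ δ) (x : X) => resolvent T (ν : ℂ) x)}

/-- The Waelbroeck spectrum `σ*(T) = ℂ \ ρ*(T)`. -/
def waelbroeckSpectrum (T : X →L[ℂ] X) : Set ℂ :=
  (waelbroeckResolventSet T)ᶜ

end Spectra

/-! ### The space of holomorphic functions on the unit disc -/

/-- Extension by zero of a function on the open unit disc. -/
noncomputable def extendZero (f : ball (0 : ℂ) 1 → ℂ) : ℂ → ℂ := by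
  classical
  exact fun z => if hz : z ∈ ball (0 : ℂ) 1 then f ⟨z, hz⟩ else 0

theorem extendZero_of_mem (f : ball (0 : ℂ) 1 → ℂ) {z : ℂ} (hz : z ∈ ball (0 : ℂ) 1) :
    extendZero f z = f ⟨z, hz⟩ := by
  exact dif_pos hz

/-- The space `H(𝔻)` of holomorphic functions on the open unit disc, as a subspace of the space
of continuous functions on the disc with the compact-open topology, that is, the topology of
uniform convergence on compact subsets. -/
noncomputable def HolDisc : Submodule ℂ C(ball (0 : ℂ) 1, ℂ) where
  carrier := {f | DifferentiableOn ℂ (extendZero f) (ball 0 1)}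
  add_mem' := by
    intro f g hf hg
    refine (DifferentiableOn.add hf hg).congr fun z hz => ?_
    simp [extendZero_of_mem _ hz]
  zero_mem' := by
    refine (differentiableOn_const (0 : ℂ)).congr fun z hz => ?_
    simp [extendZero_of_mem _ hz]
  smul_mem' := by
    intro c f hf
    refine (DifferentiableOn.const_smul hf c).congr fun z hz => ?_
    simp [extendZero_of_mem _ hz]

noncomputable instance HolDisc.instAddCommGroup : AddCommGroup HolDisc :=
  Submodule.addCommGroup HolDisc

instance HolDisc.instIsTopologicalAddGroup : IsTopologicalAddGroup HolDisc :=
  Submodule.topologicalAddGroup HolDisc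

instance HolDisc.instContinuousAdd : ContinuousAdd HolDisc :=
  HolDisc.instIsTopologicalAddGroup.toContinuousAdd

instance HolDisc.instContinuousSMul : ContinuousSMul ℂ HolDisc :=
  SMulMemClass.continuousSMul HolDisc

instance HolDisc.instContinuousConstSMul : ContinuousConstSMul ℂ HolDisc :=
  ContinuousSMul.continuousConstSMul

/-! ### The generalized Cesàro operator -/

/-- The integral `∫_0^z g(ξ) dξ` along the line segment from `0` to `z`. -/
noncomputable def segmentIntegral (g : ℂ → ℂ) (z : ℂ) : ℂ :=
  ∫ s in (0 : ℝ)..1, g (s * z) * z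

/-- The function `C_t f`: its value at `0` is `f 0`, its value at `z ≠ 0` is
`(1 / z) ∫_0^z f(ξ) / (1 - t ξ) dξ`. -/
noncomputable def cesaroFun (t : ℝ) (f : ball (0 : ℂ) 1 → ℂ) (z : ball (0 : ℂ) 1) : ℂ := by
  classical
  exact if (z : ℂ) = 0 then f ⟨0, mem_ball_self one_pos⟩
    else (1 / (z : ℂ)) * segmentIntegral (fun ξ => extendZero f ξ / (1 - t * ξ)) z

theorem ofReal_mul_mem_ball {s : ℝ} (hs : s ∈ Icc (0 : ℝ) 1) {z : ℂ} (hz : z ∈ ball (0 : ℂ) 1) :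
    (s : ℂ) * z ∈ ball (0 : ℂ) 1 := by
  rw [mem_ball_zero_iff] at hz ⊢
  rw [norm_mul, Complex.norm_real, Real.norm_of_nonneg hs.1]
  calc s * ‖z‖ ≤ 1 * ‖z‖ := by gcongr; exact hs.2
    _ < 1 := by simpa using hz

theorem one_sub_mul_ne_zero {t : ℝ} (ht : t ∈ Ico (0 : ℝ) 1) {z : ℂ} (hz : z ∈ ball (0 : ℂ) 1) :
    1 - (t : ℂ) * z ≠ 0 := by
  intro h
  have h1 := ofReal_mul_mem_ball ⟨ht.1, ht.2.le⟩ hz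
  rw [← sub_eq_zero.mp h] at h1
  simp at h1

/-- A single formula for `C_t f` on the whole disc. -/
theorem cesaroFun_eq_integral (t : ℝ) (f : ball (0 : ℂ) 1 → ℂ) (z : ball (0 : ℂ) 1) :
    cesaroFun t f z =
      ∫ s in (0 : ℝ)..1, extendZero f (s * z) / (1 - t * (s * z)) := by
  by_cases hz : (z : ℂ) = 0
  · rw [cesaroFun, if_pos hz]
    simp [hz, extendZero_of_mem f (mem_ball_self (x := (0 : ℂ)) one_pos)]
  · rw [cesaroFun, if_neg hz, segmentIntegral, intervalIntegral.integral_mul_const,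
      mul_comm _ (z : ℂ), ← mul_assoc, one_div_mul_cancel hz, one_mul]

theorem cesaroFun_differentiableOn {t : ℝ} (ht : t ∈ Ico (0 : ℝ) 1) (f : HolDisc) :
    DifferentiableOn ℂ (extendZero (cesaroFun t f.1)) (ball 0 1) := by
  set g : ℂ → ℂ := fun ξ => extendZero f.1 ξ / (1 - t * ξ) with hg
  have hgd : DifferentiableOn ℂ g (ball 0 1) := by
    refine DifferentiableOn.div f.2 (by fun_prop) ?_
    intro z hz
    exact one_sub_mul_ne_zero ht hz
  obtain ⟨G, hG⟩ := hgd.isExactOn_ball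
  have hd : DifferentiableOn ℂ (dslope G 0) (ball 0 1) :=
    (Complex.differentiableOn_dslope (ball_mem_nhds _ one_pos)).2
      fun z hz => (hG z hz).differentiableAt.differentiableWithinAt
  refine hd.congr fun z hz => ?_
  rw [extendZero_of_mem _ hz]
  by_cases hz0 : z = 0
  · subst hz0
    rw [dslope_same, (hG 0 hz).deriv]
    simp [cesaroFun, hg, extendZero]
  · rw [cesaroFun, if_neg hz0, dslope_of_ne _ hz0, slope_def_field, sub_zero, segmentIntegral]
    have hI : ∫ s in (0 : ℝ)..1, g (s * z) * z = G ((1 : ℝ) * z) - G ((0 : ℝ) * z) := by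
      have hder : ∀ s ∈ uIcc (0 : ℝ) 1, HasDerivAt (fun s : ℝ => G (s * z)) (g (s * z) * z) s := by
        intro s hs
        rw [uIcc_of_le zero_le_one] at hs
        have h2 : HasDerivAt (fun s : ℝ => (s : ℂ) * z) z s := by
          simpa using (Complex.ofRealCLM.hasDerivAt (x := s)).mul_const z
        exact (hG _ (ofReal_mul_mem_ball hs hz)).comp s h2
      refine intervalIntegral.integral_eq_sub_of_hasDerivAt hder ?_
      refine ContinuousOn.intervalIntegrable ?_
      refine ContinuousOn.mul ?_ continuousOn_const
      refine hgd.continuousOn.comp (by fun_prop) ?_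
      intro s hs
      rw [uIcc_of_le zero_le_one] at hs
      exact ofReal_mul_mem_ball hs hz
    change 1 / z * (∫ s in (0 : ℝ)..1, g (s * z) * z) = _
    rw [hI]
    simp
    ring

/-- The point `s z` of the disc, where `s` is first clamped to `[0, 1]`. -/
noncomputable def scalePt (s : ℝ) (z : ball (0 : ℂ) 1) : ball (0 : ℂ) 1 :=
  ⟨((projIcc (0 : ℝ) 1 zero_le_one s : ℝ) : ℂ) * z,
    ofReal_mul_mem_ball (projIcc (0 : ℝ) 1 zero_le_one s).2 z.2⟩

theorem continuous_scalePt : Continuous (fun p : ℝ × ball (0 : ℂ) 1 => scalePt p.1 p.2) := by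
  unfold scalePt
  refine Continuous.subtype_mk ?_ _
  have := (continuous_projIcc (a := (0 : ℝ)) (b := 1) (h := zero_le_one))
  fun_prop

theorem cesaroFun_eq_scalePt (t : ℝ) (f : ball (0 : ℂ) 1 → ℂ) (z : ball (0 : ℂ) 1) :
    cesaroFun t f z = ∫ s in (0 : ℝ)..1, f (scalePt s z) / (1 - t * (scalePt s z : ℂ)) := by
  rw [cesaroFun_eq_integral]
  refine intervalIntegral.integral_congr fun s hs => ?_
  rw [uIcc_of_le zero_le_one] at hs
  have h : (s : ℂ) * z = (scalePt s z : ℂ) := by simp [scalePt, projIcc_of_mem _ hs]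
  simp only [h]
  rw [extendZero_of_mem _ (scalePt s z).2]

theorem continuous_integrand {t : ℝ} (ht : t ∈ Ico (0 : ℝ) 1) (f : C(ball (0 : ℂ) 1, ℂ))
    (z : ball (0 : ℂ) 1) :
    Continuous (fun s : ℝ => f (scalePt s z) / (1 - t * (scalePt s z : ℂ))) := by
  have hs : Continuous (fun s : ℝ => scalePt s z) :=
    continuous_scalePt.comp (continuous_id.prodMk continuous_const)
  refine Continuous.div (f.continuous.comp hs) ?_
    fun s => one_sub_mul_ne_zero ht (scalePt s z).2
  exact continuous_const.sub (continuous_const.mul (continuous_subtype_val.comp hs))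

theorem continuous_cesaroFun {t : ℝ} (ht : t ∈ Ico (0 : ℝ) 1) :
    Continuous (fun p : C(ball (0 : ℂ) 1, ℂ) × ball (0 : ℂ) 1 => cesaroFun t p.1 p.2) := by
  have : LocallyCompactSpace (ball (0 : ℂ) 1) := isOpen_ball.locallyCompactSpace
  simp only [cesaroFun_eq_scalePt]
  refine intervalIntegral.continuous_parametric_intervalIntegral_of_continuous' ?_ 0 1
  have hs : Continuous (fun q : (C(ball (0 : ℂ) 1, ℂ) × ball (0 : ℂ) 1) × ℝ =>
      scalePt q.2 q.1.2) :=
    continuous_scalePt.comp (continuous_snd.prodMk (continuous_snd.comp continuous_fst))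
  refine Continuous.div ?_ ?_ fun q => one_sub_mul_ne_zero ht (scalePt q.2 q.1.2).2
  · exact (ContinuousEval.continuous_eval (F := C(ball (0 : ℂ) 1, ℂ))).comp
      ((continuous_fst.comp continuous_fst).prodMk hs)
  · exact continuous_const.sub (continuous_const.mul (continuous_subtype_val.comp hs))

/-- The generalized Cesàro operator `C_t`, for `0 ≤ t < 1`, as a continuous linear operator on
`H(𝔻)`. -/
noncomputable def cesaro (t : ℝ) (ht : t ∈ Ico (0 : ℝ) 1) : HolDisc →L[ℂ] HolDisc where
  toFun f := ⟨⟨cesaroFun t f.1, (continuous_cesaroFun ht).comp (by fun_prop :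
    Continuous fun z : ball (0 : ℂ) 1 => (f.1, z))⟩, cesaroFun_differentiableOn ht f⟩
  map_add' f g := by
    ext z
    simp only [ContinuousMap.coe_mk, Submodule.coe_add, ContinuousMap.add_apply]
    rw [cesaroFun_eq_scalePt, cesaroFun_eq_scalePt, cesaroFun_eq_scalePt,
      ← intervalIntegral.integral_add]
    · simp [add_div]
    · exact ((continuous_integrand ht f.1 z).intervalIntegrable 0 1)
    · exact ((continuous_integrand ht g.1 z).intervalIntegrable 0 1)
  map_smul' c f := by
    ext z
    simp only [ContinuousMap.coe_mk, Submodule.coe_smul, ContinuousMap.smul_apply]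
    rw [cesaroFun_eq_scalePt, cesaroFun_eq_scalePt]
    simp [mul_div_assoc]
  cont := by
    refine Continuous.subtype_mk ?_ _
    refine ContinuousMap.continuous_of_continuous_uncurry _ ?_
    exact (continuous_cesaroFun ht).comp (by fun_prop :
      Continuous fun p : HolDisc × ball (0 : ℂ) 1 => (p.1.1, p.2))

/-! ### Holomorphic functions on the disc as functions on the plane -/

/-! Everything rests on the differential form of the operator: `u = C_t f` iff `(z u)' = f / (1 - t
z)`. It gives the eigenfunctions `z ^ n / (1 - t z) ^ (n + 1)` with eigenvalues `1 / (n + 1)`.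
Comparing lowest Taylor coefficients in the eigenvalue equation excludes all others
(`eq_zero_of_smul_eq_cesaro`). It also gives a continuous inverse of `C_t`, so `0` is not in the
spectrum.

Let `μ` keep a positive distance from `Λ ∪ {0}`. On functions that are `O(|z| ^ N)`, `C_t` has norm
at most `1 / ((1 - t) (N + 1))` for the sup of `|f| / |z| ^ N` on a disc. For large `N` this is less
than `|μ|`, and a Neumann series solves `μ f - C_t f = h` (`exists_smul_sub_cesaro_eq_of_lt`). The
finitely many lower Taylor orders are removed one at a time with eigenfunctions, each at the cost of
dividing by `μ - 1 / (n + 1)` (`CesaroSolvable.of_succ`).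

All bounds compare sups over the same disc, with constants uniform for `μ` in a small ball, so the
resolvents are equicontinuous there. The point `0` enters `σ*` only because the eigenvalues
accumulate at it. -/

/-- An element of `H(𝔻)` as a function on the plane, extended by zero. -/
noncomputable def discFun (f : HolDisc) : ℂ → ℂ := extendZero f.1

theorem discFun_coe (f : HolDisc) (z : ball (0 : ℂ) 1) : discFun f z = f.1 z :=
  extendZero_of_mem _ z.2

theorem discFun_of_notMem (f : HolDisc) {z : ℂ} (hz : z ∉ ball (0 : ℂ) 1) : discFun f z = 0 :=
  dif_neg hz

theorem differentiableOn_discFun (f : HolDisc) : DifferentiableOn ℂ (discFun f) (ball 0 1) := f.2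

theorem differentiableAt_discFun (f : HolDisc) {z : ℂ} (hz : z ∈ ball (0 : ℂ) 1) :
    DifferentiableAt ℂ (discFun f) z :=
  (differentiableOn_discFun f).differentiableAt (isOpen_ball.mem_nhds hz)

theorem holDisc_ext {f g : HolDisc} (h : ∀ z ∈ ball (0 : ℂ) 1, discFun f z = discFun g z) :
    f = g := by
  refine Subtype.ext (ContinuousMap.ext fun z => ?_)
  rw [← discFun_coe, ← discFun_coe]
  exact h z z.2

theorem discFun_add (f g : HolDisc) (z : ℂ) : discFun (f + g) z = discFun f z + discFun g z := by
  by_cases hz : z ∈ ball (0 : ℂ) 1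
  · lift z to ball (0 : ℂ) 1 using hz
    simp [discFun_coe]
  · simp [discFun_of_notMem _ hz]

theorem discFun_sub (f g : HolDisc) (z : ℂ) : discFun (f - g) z = discFun f z - discFun g z := by
  by_cases hz : z ∈ ball (0 : ℂ) 1
  · lift z to ball (0 : ℂ) 1 using hz
    simp [discFun_coe]
  · simp [discFun_of_notMem _ hz]

theorem discFun_smul (c : ℂ) (f : HolDisc) (z : ℂ) : discFun (c • f) z = c * discFun f z := by
  by_cases hz : z ∈ ball (0 : ℂ) 1
  · lift z to ball (0 : ℂ) 1 using hz
    simp [discFun_coe]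
  · simp [discFun_of_notMem _ hz]

theorem discFun_zero (z : ℂ) : discFun (0 : HolDisc) z = 0 := by
  simpa using discFun_smul 0 0 z

/-- The element of `H(𝔻)` given by a function on the plane that is holomorphic on the disc. -/
noncomputable def discMk (F : ℂ → ℂ) (hF : DifferentiableOn ℂ F (ball 0 1)) : HolDisc :=
  ⟨⟨fun z => F z, continuousOn_iff_continuous_domRestrict.1 hF.continuousOn⟩,
    hF.congr fun _ hz => extendZero_of_mem (fun z : ball (0 : ℂ) 1 => F z) hz⟩

theorem discFun_discMk {F : ℂ → ℂ} (hF : DifferentiableOn ℂ F (ball 0 1)) {z : ℂ}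
    (hz : z ∈ ball (0 : ℂ) 1) : discFun (discMk F hF) z = F z :=
  extendZero_of_mem (fun z : ball (0 : ℂ) 1 => F z) hz

theorem hasDerivAt_mul_discFun (f : HolDisc) {z : ℂ} (hz : z ∈ ball (0 : ℂ) 1) :
    HasDerivAt (fun w => w * discFun f w) (discFun f z + z * deriv (discFun f) z) z := by
  simpa using (hasDerivAt_id' z).fun_mul (differentiableAt_discFun f hz).hasDerivAt

/-- Two elements of `H(𝔻)` agree if the derivatives of `z f(z)` and `z g(z)` do. -/
theorem holDisc_eq_of_hasDerivAt_mul {f g : HolDisc} {v : ℂ → ℂ}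
    (hf : ∀ z ∈ ball (0 : ℂ) 1, HasDerivAt (fun w => w * discFun f w) (v z) z)
    (hg : ∀ z ∈ ball (0 : ℂ) 1, HasDerivAt (fun w => w * discFun g w) (v z) z) : f = g := by
  have h0 : (0 : ℂ) ∈ ball (0 : ℂ) 1 := mem_ball_self one_pos
  have key : EqOn (fun w => w * discFun f w) (fun w => w * discFun g w) (ball 0 1) :=
    isOpen_ball.eqOn_of_deriv_eq (convex_ball (0 : ℂ) 1).isPreconnected
      (fun z hz => (hf z hz).differentiableAt.differentiableWithinAt)
      (fun z hz => (hg z hz).differentiableAt.differentiableWithinAt)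
      (fun z hz => (hf z hz).deriv.trans (hg z hz).deriv.symm) h0 (by simp)
  refine holDisc_ext fun z hz => ?_
  by_cases hz0 : z = 0
  -- At the origin the factor `z` cannot be cancelled, but `u 0` is the derivative of `w * u w`
  -- there.
  · have hval (u : HolDisc) : HasDerivAt (fun w => w * discFun u w) (discFun u 0) 0 := by
      simpa using hasDerivAt_mul_discFun u h0
    rw [hz0]
    exact ((hval f).unique (hf 0 h0)).trans ((hval g).unique (hg 0 h0)).symm
  · exact mul_left_cancel₀ hz0 (key hz)

/-! ### The Cesàro operator and its differential equation -/

section Cesaro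

variable {t : ℝ} (ht : t ∈ Ico (0 : ℝ) 1)

theorem discFun_cesaro (f : HolDisc) {z : ℂ} (hz : z ∈ ball (0 : ℂ) 1) :
    discFun (cesaro t ht f) z = ∫ s in (0 : ℝ)..1, discFun f (s * z) / (1 - t * (s * z)) := by
  lift z to ball (0 : ℂ) 1 using hz
  rw [discFun_coe]
  exact cesaroFun_eq_integral t f.1 z

/-- A primitive `G` of `f / (1 - t z)` exists on the disc, and `z C_t f(z) = G z - G 0`. From here
on `C_t` is mostly handled through this differential equation. -/
theorem hasDerivAt_mul_cesaro (f : HolDisc) {z : ℂ} (hz : z ∈ ball (0 : ℂ) 1) :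
    HasDerivAt (fun w => w * discFun (cesaro t ht f) w) (discFun f z / (1 - t * z)) z := by
  set g : ℂ → ℂ := fun ξ => (discFun f) ξ / (1 - t * ξ) with hg
  have hgd : DifferentiableOn ℂ g (ball 0 1) :=
    (differentiableOn_discFun f).div (by fun_prop) fun z hz => one_sub_mul_ne_zero ht hz
  obtain ⟨G, hG⟩ := hgd.isExactOn_ball
  refine ((hG z hz).sub_const (G 0)).congr_of_eventuallyEq ?_
  filter_upwards [isOpen_ball.mem_nhds hz] with w hw
  have hI : ∫ s in (0 : ℝ)..1, g (s * w) * w = G ((1 : ℝ) * w) - G ((0 : ℝ) * w) := by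
    have hder : ∀ s ∈ uIcc (0 : ℝ) 1, HasDerivAt (fun s : ℝ => G (s * w)) (g (s * w) * w) s := by
      intro s hs
      rw [uIcc_of_le zero_le_one] at hs
      have h2 : HasDerivAt (fun s : ℝ => (s : ℂ) * w) w s := by
        simpa using (Complex.ofRealCLM.hasDerivAt (x := s)).mul_const w
      exact (hG _ (ofReal_mul_mem_ball hs hw)).comp s h2
    refine intervalIntegral.integral_eq_sub_of_hasDerivAt hder ?_
    refine (ContinuousOn.mul (hgd.continuousOn.comp (by fun_prop) ?_)
      continuousOn_const).intervalIntegrable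
    intro s hs
    rw [uIcc_of_le zero_le_one] at hs
    exact ofReal_mul_mem_ball hs hw
  rw [discFun_cesaro ht f hw]
  rw [intervalIntegral.integral_mul_const] at hI
  simpa [mul_comm w] using hI

theorem cesaro_eq_of_hasDerivAt {f u : HolDisc}
    (h : ∀ z ∈ ball (0 : ℂ) 1, HasDerivAt (fun w => w * discFun u w) (discFun f z / (1 - t * z)) z) :
    cesaro t ht f = u :=
  holDisc_eq_of_hasDerivAt_mul (fun _ hz => hasDerivAt_mul_cesaro ht f hz) h

/-- The eigenfunction `z ^ n / (1 - t z) ^ (n + 1)`. -/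
noncomputable def cesaroEigen (n : ℕ) : HolDisc :=
  discMk (fun z => z ^ n / (1 - t * z) ^ (n + 1))
    (DifferentiableOn.div (by fun_prop) (by fun_prop)
      fun _ hz => pow_ne_zero _ (one_sub_mul_ne_zero ht hz))

theorem discFun_cesaroEigen (n : ℕ) {z : ℂ} (hz : z ∈ ball (0 : ℂ) 1) :
    discFun (cesaroEigen ht n) z = z ^ n / (1 - t * z) ^ (n + 1) :=
  discFun_discMk _ hz

/-- With `w = z / (1 - t z)` one has `w' = 1 / (1 - t z) ^ 2`, so `w ^ (n + 1) / (n + 1)` has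
derivative `z ^ n / (1 - t z) ^ (n + 2)`. -/
theorem cesaro_cesaroEigen (n : ℕ) :
    cesaro t ht (cesaroEigen ht n) = (1 / ((n : ℂ) + 1)) • cesaroEigen ht n := by
  refine cesaro_eq_of_hasDerivAt ht fun z hz => ?_
  have hne := one_sub_mul_ne_zero ht hz
  have hn : (n : ℂ) + 1 ≠ 0 := by exact_mod_cast n.succ_ne_zero
  have h1 : HasDerivAt (fun w : ℂ => 1 - (t : ℂ) * w) (-t) z := by
    simpa using ((hasDerivAt_id z).const_mul (t : ℂ)).const_sub 1
  have h2 := (((hasDerivAt_id' z).fun_div h1 hne).fun_pow (n + 1)).const_mul (1 / ((n : ℂ) + 1))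
  rw [discFun_cesaroEigen ht n hz]
  refine (h2.congr_of_eventuallyEq ?_).congr_deriv ?_
  · filter_upwards [isOpen_ball.mem_nhds hz] with w hw
    rw [discFun_smul, discFun_cesaroEigen ht n hw]
    simp [div_pow]
    ring
  · simp only [Nat.add_sub_cancel, div_pow]
    push_cast
    field_simp
    ring

theorem cesaroEigen_ne_zero (n : ℕ) : cesaroEigen ht n ≠ 0 := by
  intro h
  have hz : (1 / 2 : ℂ) ∈ ball (0 : ℂ) 1 := by
    rw [mem_ball_zero_iff]; norm_num
  have h1 := discFun_cesaroEigen ht n hz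
  rw [h, discFun_zero] at h1
  exact div_ne_zero (pow_ne_zero _ (by norm_num)) (pow_ne_zero _ (one_sub_mul_ne_zero ht hz)) h1.symm

/-- If `f ≠ 0`, write `f = z ^ n g` near `0` with `g 0 ≠ 0`. The lowest coefficients in `μ (z f)' (1
- t z) = f` give `μ (n + 1) = 1`; this covers `μ = 0` too. -/
theorem eq_zero_of_smul_eq_cesaro {μ : ℂ} (hμ : μ ∉ range fun n : ℕ => 1 / ((n : ℂ) + 1))
    {f : HolDisc} (h : μ • f = cesaro t ht f) : f = 0 := by
  have h0 : (0 : ℂ) ∈ ball (0 : ℂ) 1 := mem_ball_self one_pos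
  have han : AnalyticOnNhd ℂ (discFun f) (ball 0 1) := (differentiableOn_discFun f).analyticOnNhd isOpen_ball
  by_cases hz : ∀ᶠ z in 𝓝 (0 : ℂ), discFun f z = 0
  · refine holDisc_ext fun z hz' => ?_
    rw [discFun_zero]
    exact han.eqOn_zero_of_preconnected_of_eventuallyEq_zero
      (convex_ball (0 : ℂ) 1).isPreconnected h0 hz hz'
  obtain ⟨n, g, hg, hg0, hfg⟩ := (han 0 h0).exists_eventuallyEq_pow_smul_nonzero_iff.2 hz
  simp only [sub_zero, smul_eq_mul] at hfg
  have hode : ∀ᶠ z in 𝓝 (0 : ℂ), z ^ n * (μ * ((n + 1) * g z + z * deriv g z) * (1 - t * z)) =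
      z ^ n * g z := by
    filter_upwards [hfg.eventually_nhds, hg.eventually_analyticAt,
      isOpen_ball.mem_nhds h0] with z hz hgz hzb
    have h1 := hasDerivAt_mul_cesaro ht f hzb
    rw [← h] at h1
    have h2 : HasDerivAt (fun w => μ * (w ^ (n + 1) * g w))
        (μ * ((((n + 1 : ℕ) : ℂ) * z ^ n) * g z + z ^ (n + 1) * deriv g z)) z := by
      simpa using ((hasDerivAt_pow (n + 1) z).mul hgz.differentiableAt.hasDerivAt).const_mul μ
    have h3 := h1.unique (h2.congr_of_eventuallyEq (by
      filter_upwards [hz] with w hw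
      rw [discFun_smul, hw]; ring))
    rw [div_eq_iff (one_sub_mul_ne_zero ht hzb), hz.self_of_nhds] at h3
    rw [h3]; push_cast; ring
  have hode' : ∀ᶠ z in 𝓝[≠] (0 : ℂ), μ * ((n + 1) * g z + z * deriv g z) * (1 - t * z) = g z := by
    filter_upwards [hode.filter_mono nhdsWithin_le_nhds, self_mem_nhdsWithin] with z hz hz0
    exact mul_left_cancel₀ (pow_ne_zero n hz0) hz
  have hc : ContinuousAt (fun z => μ * ((n + 1) * g z + z * deriv g z) * (1 - t * z)) 0 := by
    have := hg.continuousAt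
    have := hg.deriv.continuousAt
    fun_prop
  -- Cancelling `z ^ n` is valid only off the origin; continuity carries the identity to `z = 0`.
  have hlim := tendsto_nhds_unique (hc.tendsto.mono_left nhdsWithin_le_nhds)
    ((hg.continuousAt.tendsto.mono_left nhdsWithin_le_nhds).congr'
      (hode'.mono fun _ hz => hz.symm))
  simp only [zero_mul, add_zero, mul_zero, sub_zero, mul_one] at hlim
  refine absurd ⟨n, ?_⟩ hμ
  have hn : (n : ℂ) + 1 ≠ 0 := by exact_mod_cast n.succ_ne_zero
  have : μ * (n + 1) = 1 := mul_right_cancel₀ hg0 (by linear_combination hlim)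
  exact (eq_div_of_mul_eq hn this).symm

/-- The inverse of the Cesàro operator: `g ↦ (1 - t z) (z g(z))'`. -/
theorem isUnit_cesaro : IsUnit (cesaro t ht) := by
  have hdiff (g : HolDisc) : DifferentiableOn ℂ
      (fun z => (1 - t * z) * (discFun g z + z * deriv (discFun g) z)) (ball 0 1) := by
    have h1 := (differentiableOn_discFun g)
    have h2 := h1.deriv isOpen_ball
    fun_prop
  let S : HolDisc → HolDisc := fun g => discMk _ (hdiff g)
  have hS (g : HolDisc) {z : ℂ} (hz : z ∈ ball (0 : ℂ) 1) :
      discFun (S g) z = (1 - t * z) * (discFun g z + z * deriv (discFun g) z) :=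
    discFun_discMk _ hz
  have hTS (g : HolDisc) : cesaro t ht (S g) = g := by
    refine cesaro_eq_of_hasDerivAt ht fun z hz => ?_
    rw [hS g hz, mul_div_cancel_left₀ _ (one_sub_mul_ne_zero ht hz)]
    exact hasDerivAt_mul_discFun g hz
  have hinj : Function.Injective (cesaro t ht) := by
    intro f g hfg
    refine holDisc_ext fun z hz => ?_
    have h1 := hasDerivAt_mul_cesaro ht f hz
    rw [hfg] at h1
    exact (div_left_inj' (one_sub_mul_ne_zero ht hz)).1 (h1.unique (hasDerivAt_mul_cesaro ht g hz))
  have hcont : Continuous S := by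
    have : LocallyCompactSpace (ball (0 : ℂ) 1) := isOpen_ball.locallyCompactSpace
    -- Weierstrass: locally uniform convergence of holomorphic functions passes to derivatives.
    have hD : Continuous fun g : HolDisc =>
        (discMk (deriv (discFun g)) ((differentiableOn_discFun g).deriv isOpen_ball)).1 := by
      refine continuous_iff_continuousAt.2 fun g => ?_
      refine ContinuousMap.tendsto_iff_tendstoLocallyUniformly.2 ?_
      have h1 : TendstoLocallyUniformlyOn discFun (discFun g) (𝓝 g)
          (ball 0 1) := by
        rw [tendstoLocallyUniformlyOn_iff_tendstoLocallyUniformly_comp_coe]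
        have := ContinuousMap.tendsto_iff_tendstoLocallyUniformly.1
          (continuous_subtype_val.tendsto g)
        simpa [Function.comp_def, discFun_coe] using this
      have h2 := h1.deriv (Eventually.of_forall fun u => (differentiableOn_discFun u)) isOpen_ball
      rw [tendstoLocallyUniformlyOn_iff_tendstoLocallyUniformly_comp_coe] at h2
      exact h2
    let ι : C(ball (0 : ℂ) 1, ℂ) := ⟨Subtype.val, continuous_subtype_val⟩
    have hS' : ∀ g : HolDisc, (S g).1 = (1 - (t : ℂ) • ι) * (g.1 +
        ι * (discMk (deriv (discFun g)) ((differentiableOn_discFun g).deriv isOpen_ball)).1) := by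
      intro g
      ext z
      rw [← discFun_coe, hS g z.2]
      simp [ι, ← discFun_coe, discFun_discMk _ z.2]
    refine Continuous.subtype_mk (p := fun x => x ∈ HolDisc) (f := fun g => (S g).1) ?_
      fun g => (S g).2
    simp only [hS']
    exact continuous_const.mul (continuous_subtype_val.add (continuous_const.mul hD))
  let e : HolDisc ≃L[ℂ] HolDisc :=
    { LinearEquiv.ofBijective (cesaro t ht).toLinearMap ⟨hinj, fun g => ⟨S g, hTS g⟩⟩ with
      continuous_toFun := (cesaro t ht).cont
      continuous_invFun := by
        refine hcont.congr fun g => hinj ?_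
        rw [hTS]
        exact (LinearEquiv.apply_symm_apply (LinearEquiv.ofBijective (cesaro t ht).toLinearMap
          ⟨hinj, fun g => ⟨S g, hTS g⟩⟩) g).symm }
  exact ⟨ContinuousLinearEquiv.toUnit e, ContinuousLinearMap.ext fun _ => rfl⟩

end Cesaro

/-! ### Sums in `H(𝔻)` -/

theorem exists_norm_lt_of_isCompact {K : Set (ball (0 : ℂ) 1)} (hK : IsCompact K) :
    ∃ r ∈ Ioo (0 : ℝ) 1, ∀ z ∈ K, ‖(z : ℂ)‖ < r := by
  rcases K.eq_empty_or_nonempty with rfl | hne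
  · exact ⟨1 / 2, by norm_num, fun z hz => hz.elim⟩
  · obtain ⟨w, -, hw⟩ := hK.exists_isMaxOn hne
      (f := fun z : ball (0 : ℂ) 1 => ‖(z : ℂ)‖) (by fun_prop)
    obtain ⟨r, hwr, hr⟩ := exists_between (mem_ball_zero_iff.1 w.2)
    exact ⟨r, ⟨(norm_nonneg _).trans_lt hwr, hr⟩, fun z hz => (hw hz).trans_lt hwr⟩

/-- A pointwise majorised series converges in `H(𝔻)`. -/
theorem summable_holDisc {F : ℕ → HolDisc}
    (hF : ∀ r < (1 : ℝ), ∃ b : ℕ → ℝ, Summable b ∧ ∀ k z, ‖z‖ < r → ‖discFun (F k) z‖ ≤ b k) :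
    Summable F := by
  have : LocallyCompactSpace (ball (0 : ℂ) 1) := isOpen_ball.locallyCompactSpace
  have hs : Summable fun k => (F k).1 := by
    refine ContinuousMap.summable_of_locally_summable_norm fun K => ?_
    obtain ⟨r, hr, hK⟩ := exists_norm_lt_of_isCompact K.isCompact
    obtain ⟨b, hb, hbF⟩ := hF r hr.2
    refine Summable.of_nonneg_of_le (fun _ => norm_nonneg _) (fun k => ?_) hb.abs
    rw [ContinuousMap.norm_le _ (abs_nonneg _)]
    intro z
    have := hbF k z.1 (hK _ z.2)
    rw [discFun_coe] at this
    exact this.trans (le_abs_self _)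
  obtain ⟨f, hf⟩ := hs
  -- The sum was formed among continuous functions; it is holomorphic as a locally uniform limit of
  -- holomorphic ones.
  have hmem : f ∈ HolDisc := by
    have h1 := ContinuousMap.tendsto_iff_tendstoLocallyUniformly.1 hf
    have h2 : TendstoLocallyUniformlyOn (fun s : Finset ℕ => discFun (∑ k ∈ s, F k))
        (extendZero f) (SummationFilter.unconditional ℕ).filter (ball 0 1) := by
      rw [tendstoLocallyUniformlyOn_iff_tendstoLocallyUniformly_comp_coe]
      convert h1 using 2 with s
      · ext z
        simp [discFun_coe]
      · exact funext fun z => extendZero_of_mem f z.2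
    exact h2.differentiableOn (Eventually.of_forall fun s => differentiableOn_discFun _) isOpen_ball
  refine ⟨⟨f, hmem⟩, tendsto_subtype_rng.2 ?_⟩
  refine hf.congr fun s => ?_
  simp

theorem hasSum_discFun {F : ℕ → HolDisc} (hF : Summable F) {z : ℂ} (hz : z ∈ ball (0 : ℂ) 1) :
    HasSum (fun k => discFun (F k) z) (discFun (∑' k, F k) z) := by
  let φ : HolDisc →+ ℂ :=
    { toFun := fun f => discFun f z
      map_zero' := discFun_zero z
      map_add' := fun f g => discFun_add f g z }
  have hφ : Continuous φ := by
    have : (φ : HolDisc → ℂ) = fun f => f.1 ⟨z, hz⟩ := funext fun f => discFun_coe f ⟨z, hz⟩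
    rw [this]
    exact (ContinuousEvalConst.continuous_eval_const _).comp continuous_subtype_val
  exact hF.hasSum.map φ hφ

/-! ### Neumann series on functions of high vanishing order -/

section Cesaro

variable {t : ℝ} (ht : t ∈ Ico (0 : ℝ) 1)

theorem one_sub_le_norm_one_sub_mul {t : ℝ} (ht : t ∈ Ico (0 : ℝ) 1) {z : ℂ} (hz : ‖z‖ < 1) :
    1 - t ≤ ‖1 - (t : ℂ) * z‖ := by
  have h1 := norm_sub_norm_le (1 : ℂ) (t * z)
  rw [norm_one, norm_mul, Complex.norm_real, Real.norm_of_nonneg ht.1] at h1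
  nlinarith [ht.1]

/-- The Cesàro operator contracts more and more on functions vanishing at `0` to high order. -/
theorem norm_cesaro_le {N : ℕ} {M r : ℝ} (hr : r ≤ 1) {f : HolDisc}
    (hf : ∀ z, ‖z‖ < r → ‖discFun f z‖ ≤ M * ‖z‖ ^ N) {z : ℂ} (hz : ‖z‖ < r) :
    ‖discFun (cesaro t ht f) z‖ ≤ 1 / ((1 - t) * (N + 1)) * M * ‖z‖ ^ N := by
  have ht1 : 0 < 1 - t := sub_pos.2 ht.2
  rw [discFun_cesaro ht f (mem_ball_zero_iff.2 (hz.trans_le hr))]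
  -- The gain `1 / (N + 1)` is `∫ s ^ N`; the factor `1 / (1 - t)` bounds the kernel.
  calc _ ≤ ∫ s in (0 : ℝ)..1, M * ‖z‖ ^ N / (1 - t) * s ^ N := by
        refine intervalIntegral.norm_integral_le_of_norm_le zero_le_one
          (Eventually.of_forall fun s hs => ?_)
          (Continuous.intervalIntegrable (by fun_prop) _ _)
        have hsz : ‖(s : ℂ) * z‖ = s * ‖z‖ := by
          rw [norm_mul, Complex.norm_real, Real.norm_of_nonneg hs.1.le]
        have hsz' : ‖(s : ℂ) * z‖ < r := by
          rw [hsz]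
          exact (mul_le_of_le_one_left (norm_nonneg z) hs.2).trans_lt hz
        have h1 := hf _ hsz'
        have h2 := one_sub_le_norm_one_sub_mul ht (hsz'.trans_le hr)
        rw [norm_div]
        calc _ ≤ M * ‖(s : ℂ) * z‖ ^ N / (1 - t) :=
              div_le_div₀ ((norm_nonneg _).trans h1) h1 ht1 h2
          _ = _ := by rw [hsz, mul_pow]; ring
    _ = _ := by
        rw [intervalIntegral.integral_const_mul, integral_pow]
        have : (N : ℝ) + 1 ≠ 0 := by positivity
        simp
        field_simp

/-- Neumann series for `(μ I - C_t)⁻¹` on functions vanishing at `0` to high order. -/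
theorem exists_smul_sub_cesaro_eq_of_lt {N : ℕ} {ε : ℝ} (hN : 1 / ((1 - t) * (N + 1)) < ε)
    {μ : ℂ} (hμ : ε ≤ ‖μ‖) {h : HolDisc} {g : ℂ → ℂ} (hg : ContinuousOn g (ball 0 1))
    (hgh : ∀ z ∈ ball (0 : ℂ) 1, discFun h z = z ^ N * g z) :
    ∃ f : HolDisc, μ • f - cesaro t ht f = h ∧ ∀ r ∈ Ioo (0 : ℝ) 1, ∀ M : ℝ,
      (∀ z, ‖z‖ < r → ‖g z‖ ≤ M) → ∀ z, ‖z‖ < r →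
        ‖discFun f z‖ ≤ 1 / (ε - 1 / ((1 - t) * (N + 1))) * M := by
  have ht1 : 0 < 1 - t := sub_pos.2 ht.2
  set q := 1 / ((1 - t) * (N + 1)) with hq
  have hq0 : 0 < q := by positivity
  have hε : 0 < ε := hq0.trans hN
  have hμ0 : μ ≠ 0 := norm_pos_iff.1 (hε.trans_le hμ)
  have hμi : ‖μ⁻¹‖ ≤ ε⁻¹ := by
    rw [norm_inv]
    exact inv_anti₀ hε hμ
  let F : ℕ → HolDisc := fun k => (fun f => μ⁻¹ • cesaro t ht f)^[k] (μ⁻¹ • h)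
  have hF0 : F 0 = μ⁻¹ • h := rfl
  have hFs (k : ℕ) : F (k + 1) = μ⁻¹ • cesaro t ht (F k) := Function.iterate_succ_apply' _ _ _
  -- The factor `‖z‖ ^ N` must survive in the induction, since it is what makes each application of
  -- `C_t` contract by `q`.
  have hbound {r M : ℝ} (hr : r ∈ Ioo (0 : ℝ) 1) (hM : ∀ z, ‖z‖ < r → ‖g z‖ ≤ M) (k : ℕ) :
      ∀ z, ‖z‖ < r → ‖discFun (F k) z‖ ≤ ε⁻¹ * M * (q / ε) ^ k * ‖z‖ ^ N := by
    have hM0 : 0 ≤ M := (norm_nonneg _).trans (hM 0 (by simpa using hr.1))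
    induction k with
    | zero =>
      intro z hz
      rw [hF0, discFun_smul, hgh z (mem_ball_zero_iff.2 (hz.trans hr.2)), norm_mul, norm_mul,
        norm_pow]
      calc _ ≤ ε⁻¹ * (‖z‖ ^ N * M) := by gcongr; exact hM z hz
        _ = _ := by ring
    | succ k ih =>
      intro z hz
      rw [hFs, discFun_smul, norm_mul]
      calc _ ≤ ε⁻¹ * (q * (ε⁻¹ * M * (q / ε) ^ k) * ‖z‖ ^ N) :=
            mul_le_mul hμi (norm_cesaro_le ht hr.2.le ih hz) (norm_nonneg _) (by positivity)
        _ = _ := by rw [pow_succ]; ring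
  have hqε : q / ε < 1 := (div_lt_one hε).2 hN
  have hgeom (M : ℝ) : HasSum (fun k : ℕ => ε⁻¹ * M * (q / ε) ^ k) (1 / (ε - q) * M) := by
    have hne : ε - q ≠ 0 := (sub_pos.2 hN).ne'
    have hsum_eq : 1 / (ε - q) * M = ε⁻¹ * M * (1 - q / ε)⁻¹ := by
      rw [one_sub_div hε.ne', inv_div]
      field_simp
    rw [hsum_eq]
    exact (hasSum_geometric_of_lt_one (by positivity) hqε).mul_left (ε⁻¹ * M)
  have hbound' {r M : ℝ} (hr : r ∈ Ioo (0 : ℝ) 1) (hM : ∀ z, ‖z‖ < r → ‖g z‖ ≤ M) (k : ℕ) :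
      ∀ z, ‖z‖ < r → ‖discFun (F k) z‖ ≤ ε⁻¹ * M * (q / ε) ^ k := by
    intro z hz
    have hM0 : 0 ≤ M := (norm_nonneg _).trans (hM 0 (by simpa using hr.1))
    exact (hbound hr hM k z hz).trans (mul_le_of_le_one_right (by positivity)
      (pow_le_one₀ (norm_nonneg z) (hz.trans hr.2).le))
  have hsum : Summable F := by
    refine summable_holDisc fun r hr => ?_
    -- `r` may be nonpositive here, and `g` need not be bounded on the whole disc: a positive radius
    -- `s < 1` beyond `r` serves for both.
    obtain ⟨s, hs, hs1⟩ := exists_between (max_lt hr one_pos)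
    have hs0 : 0 < s := (le_max_right _ _).trans_lt hs
    obtain ⟨M, hM⟩ := (isCompact_closedBall (0 : ℂ) s).exists_bound_of_continuousOn
      (hg.mono (closedBall_subset_ball hs1))
    exact ⟨_, (hgeom M).summable, fun k z hz => hbound' ⟨hs0, hs1⟩
      (fun z hz => hM z (mem_closedBall_zero_iff.2 hz.le)) k z
      (hz.trans ((le_max_left _ _).trans_lt hs))⟩
  refine ⟨∑' k, F k, ?_, fun r hr M hM z hz => ?_⟩
  · have h1 : ∑' k, F k = μ⁻¹ • h + μ⁻¹ • cesaro t ht (∑' k, F k) := by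
      conv_lhs => rw [hsum.tsum_eq_zero_add]
      rw [(cesaro t ht).map_tsum hsum, ← ((cesaro t ht).summable hsum).tsum_const_smul μ⁻¹, hF0]
      simp only [hFs]
    have h2 := congrArg (fun f => μ • f) h1
    simp only [smul_add, smul_inv_smul₀ hμ0] at h2
    rw [h2, add_sub_cancel_right]
  · exact (hasSum_discFun hsum (mem_ball_zero_iff.2 (hz.trans hr.2))).norm_le_of_bounded (hgeom M)
      fun k => hbound' hr hM k z hz

end Cesaro

/-! ### Solving `μ f - C_t f = h` with bounds uniform in `μ` -/

/-- For all `μ ∈ U`, the equation `μ f - C_t f = z ^ N g` has a solution in `H(𝔻)` which is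
bounded on each disc in terms of `g` on that disc, uniformly in `μ`. -/
def CesaroSolvable {t : ℝ} (ht : t ∈ Ico (0 : ℝ) 1) (U : Set ℂ) (N : ℕ) : Prop :=
  ∃ C : ℝ → ℝ, ∀ μ ∈ U, ∀ (h : HolDisc) (g : ℂ → ℂ), DifferentiableOn ℂ g (ball 0 1) →
    (∀ z ∈ ball (0 : ℂ) 1, discFun h z = z ^ N * g z) →
    ∃ f : HolDisc, μ • f - cesaro t ht f = h ∧ ∀ r ∈ Ioo (0 : ℝ) 1, ∀ M : ℝ,
      (∀ z, ‖z‖ < r → ‖g z‖ ≤ M) → ∀ z, ‖z‖ < r → ‖discFun f z‖ ≤ C r * M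

section Cesaro

variable {t : ℝ} (ht : t ∈ Ico (0 : ℝ) 1)

/-- Subtracting `g 0` times the `N`-th eigenfunction from `h` kills the coefficient of `z ^ N`,
leaving `z ^ (N + 1)` times a holomorphic function. On the eigenfunction the equation is solved by
dividing by `μ - 1 / (N + 1)`. -/
theorem CesaroSolvable.of_succ {U : Set ℂ} {δ : ℝ} (hδ : 0 < δ) {N : ℕ}
    (hU : ∀ μ ∈ U, δ ≤ ‖μ - 1 / ((N : ℂ) + 1)‖) (hs : CesaroSolvable ht U (N + 1)) :
    CesaroSolvable ht U N := by
  obtain ⟨C, hC⟩ := hs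
  have ht1 : 0 < 1 - t := sub_pos.2 ht.2
  have h0 : (0 : ℂ) ∈ ball (0 : ℂ) 1 := mem_ball_self one_pos
  set A := 1 / (1 - t) ^ (N + 1) with hA
  have hA0 : 0 < A := by positivity
  have hAle {z : ℂ} (hz : ‖z‖ < 1) : ‖1 / (1 - (t : ℂ) * z) ^ (N + 1)‖ ≤ A := by
    rw [norm_div, norm_one, norm_pow]
    exact one_div_le_one_div_of_le (by positivity)
      (pow_le_pow_left₀ ht1.le (one_sub_le_norm_one_sub_mul ht hz) _)
  -- `A / δ` pays for the eigenfunction term, and `(1 + A) / r` for the remainder after division by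
  -- `z`.
  refine ⟨fun r => A / δ + C r * ((1 + A) / r), fun μ hμ h g hg hgh => ?_⟩
  have hμN := hU μ hμ
  have hμ0 : μ - 1 / ((N : ℂ) + 1) ≠ 0 := norm_pos_iff.1 (hδ.trans_le hμN)
  set k : ℂ → ℂ := fun z => g z - g 0 * (1 / (1 - t * z) ^ (N + 1)) with hk
  have hkd : DifferentiableOn ℂ k (ball 0 1) := by
    refine hg.sub (DifferentiableOn.const_mul (DifferentiableOn.div (by fun_prop) (by fun_prop)
      fun _ hz => pow_ne_zero _ (one_sub_mul_ne_zero ht hz)) _)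
  have hk0 : k 0 = 0 := by simp [hk]
  have hkz (z : ℂ) : z * dslope k 0 z = k z := by
    simpa [hk0] using sub_smul_dslope k 0 z
  obtain ⟨f, hf, hfb⟩ := hC μ hμ (h - g 0 • cesaroEigen ht N) (dslope k 0)
    ((Complex.differentiableOn_dslope (ball_mem_nhds _ one_pos)).2 hkd) fun z hz => by
      rw [pow_succ, mul_assoc, hkz, discFun_sub, discFun_smul, hgh z hz,
        discFun_cesaroEigen ht N hz]
      simp only [hk]
      ring
  refine ⟨(g 0 / (μ - 1 / ((N : ℂ) + 1))) • cesaroEigen ht N + f, ?_, fun r hr M hM z hz => ?_⟩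
  · rw [map_add, map_smul, cesaro_cesaroEigen]
    have h1 : (g 0 / (μ - 1 / ((N : ℂ) + 1))) * (μ - 1 / ((N : ℂ) + 1)) = g 0 :=
      div_mul_cancel₀ _ hμ0
    have h2 := congrArg (fun c : ℂ => c • cesaroEigen ht N) h1
    rw [eq_sub_iff_add_eq, ← h2] at hf
    rw [← hf]
    module
  · have hg0 : ‖g 0‖ ≤ M := hM 0 (by simpa using hr.1)
    have hM0 : 0 ≤ M := (norm_nonneg _).trans hg0
    have hkM {w : ℂ} (hw : ‖w‖ < r) : ‖k w‖ ≤ M + M * A := by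
      refine (norm_sub_le _ _).trans (add_le_add (hM w hw) ?_)
      rw [norm_mul]
      exact mul_le_mul hg0 (hAle (hw.trans hr.2)) (norm_nonneg _) hM0
    -- Schwarz lemma: dividing by `z` costs a factor `1 / r` without shrinking the disc.
    have hdk : ∀ w, ‖w‖ < r → ‖dslope k 0 w‖ ≤ (M + M * A) / r := fun w hw =>
      Complex.norm_dslope_le_div_of_mapsTo_ball (hkd.mono (ball_subset_ball hr.2.le))
        (fun v hv => by
          rw [hk0, mem_closedBall_zero_iff]
          exact hkM (mem_ball_zero_iff.1 hv)) (mem_ball_zero_iff.2 hw)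
    have he : ‖discFun (cesaroEigen ht N) z‖ ≤ A := by
      rw [discFun_cesaroEigen ht N (mem_ball_zero_iff.2 (hz.trans hr.2)), div_eq_mul_one_div,
        norm_mul, norm_pow]
      exact (mul_le_of_le_one_left (norm_nonneg _)
        (pow_le_one₀ (norm_nonneg z) (hz.trans hr.2).le)).trans (hAle (hz.trans hr.2))
    rw [discFun_add, discFun_smul]
    calc _ ≤ M / δ * A + C r * ((M + M * A) / r) := by
          refine (norm_add_le _ _).trans (add_le_add ?_ (hfb r hr _ hdk z hz))
          rw [norm_mul, norm_div]
          exact mul_le_mul (div_le_div₀ hM0 hg0 hδ hμN) he (norm_nonneg _) (by positivity)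
      _ = _ := by ring

/-- The starting order `N` depends only on `ε` and `t`, so the Neumann series works for all of `U`
at once; then the order descends to `0`. -/
theorem cesaroSolvable_zero {U : Set ℂ} {ε δ : ℝ} (hε : 0 < ε) (hδ : 0 < δ)
    (hU : ∀ μ ∈ U, ε ≤ ‖μ‖) (hU' : ∀ μ ∈ U, ∀ n : ℕ, δ ≤ ‖μ - 1 / ((n : ℂ) + 1)‖) :
    CesaroSolvable ht U 0 := by
  have ht1 : 0 < 1 - t := sub_pos.2 ht.2
  obtain ⟨N, hN⟩ := exists_nat_one_div_lt (mul_pos hε ht1)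
  have hN' : 1 / ((1 - t) * ((N : ℝ) + 1)) < ε := by
    rw [mul_comm, ← div_div]
    exact (div_lt_iff₀ ht1).2 hN
  have hs : CesaroSolvable ht U N := ⟨_, fun μ hμ h g hg hgh =>
    exists_smul_sub_cesaro_eq_of_lt ht hN' (hU μ hμ) hg.continuousOn hgh⟩
  clear hN hN'
  induction N with
  | zero => exact hs
  | succ N ih => exact ih (hs.of_succ ht hδ fun μ hμ => hU' μ hμ N)

end Cesaro

/-! ### Neighbourhoods of zero in `H(𝔻)` -/

/-- Compact subsets of the disc lie in smaller concentric discs, so sups over `‖z‖ < r` suffice to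
describe the topology; `setOf_bound_mem_nhds_zero` is the converse half. -/
theorem exists_bound_subset_of_mem_nhds_zero {V : Set HolDisc} (hV : V ∈ 𝓝 (0 : HolDisc)) :
    ∃ r ∈ Ioo (0 : ℝ) 1, ∃ ε > 0, ∀ f : HolDisc, (∀ z, ‖z‖ < r → ‖discFun f z‖ ≤ ε) → f ∈ V := by
  obtain ⟨W, hW, hWV⟩ := mem_nhds_induced _ _ _ |>.1 hV
  obtain ⟨⟨K, ε⟩, ⟨hK, hε⟩, hKW⟩ := (nhds_basis_uniformity'
    (Metric.uniformity_basis_dist_le.compactConvergenceUniformity)).mem_iff.1 hW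
  obtain ⟨r, hr, hKr⟩ := exists_norm_lt_of_isCompact hK
  refine ⟨r, hr, ε, hε, fun f hf => hWV (hKW fun z hz => ?_)⟩
  have := hf z (hKr z hz)
  rw [discFun_coe] at this
  simpa using this

theorem setOf_bound_mem_nhds_zero {r ε : ℝ} (hr : r < 1) (hε : 0 < ε) :
    {f : HolDisc | ∀ z, ‖z‖ < r → ‖discFun f z‖ ≤ ε} ∈ 𝓝 (0 : HolDisc) := by
  have hK : IsCompact {z : ball (0 : ℂ) 1 | ‖(z : ℂ)‖ ≤ r} := by
    rw [Subtype.isCompact_iff]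
    convert isCompact_closedBall (0 : ℂ) r using 1
    ext z
    simp only [mem_image, mem_ofPred_eq, Subtype.exists, mem_ball_zero_iff, mem_closedBall_zero_iff]
    exact ⟨fun ⟨w, _, hw, hwz⟩ => hwz ▸ hw, fun hz => ⟨z, hz.trans_lt hr, hz, rfl⟩⟩
  refine (mem_nhds_induced _ _ _).2 ⟨_, (nhds_basis_uniformity'
    (Metric.uniformity_basis_dist_le.compactConvergenceUniformity)).mem_of_mem
      (i := (_, ε)) ⟨hK, hε⟩, fun f hf z hz => ?_⟩
  have := hf ⟨z, mem_ball_zero_iff.2 (hz.trans hr)⟩ hz.le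
  rw [discFun_coe f ⟨z, mem_ball_zero_iff.2 (hz.trans hr)⟩]
  simpa using this

/-- A family of linear maps that satisfies uniform bounds is equicontinuous at zero. -/
theorem exists_nhds_zero_forall_mem {C : ℝ → ℝ} {V : Set HolDisc} (hV : V ∈ 𝓝 (0 : HolDisc)) :
    ∃ W ∈ 𝓝 (0 : HolDisc), ∀ f h : HolDisc, h ∈ W →
      (∀ r ∈ Ioo (0 : ℝ) 1, ∀ M : ℝ, (∀ z, ‖z‖ < r → ‖discFun h z‖ ≤ M) →
        ∀ z, ‖z‖ < r → ‖discFun f z‖ ≤ C r * M) → f ∈ V := by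
  obtain ⟨r, hr, ε, hε, hrV⟩ := exists_bound_subset_of_mem_nhds_zero hV
  -- Nothing is known about the sign of `C r`, hence this positive majorant.
  have hC : 0 < |C r| + 1 := by positivity
  refine ⟨_, setOf_bound_mem_nhds_zero hr.2 (div_pos hε hC), fun f h hh hb => hrV f fun z hz => ?_⟩
  refine (hb r hr _ hh z hz).trans ?_
  calc C r * (ε / (|C r| + 1)) ≤ (|C r| + 1) * (ε / (|C r| + 1)) := by
        gcongr
        exact (le_abs_self _).trans (le_add_of_nonneg_right zero_le_one)
    _ = ε := by field_simp

/-- A bijective operator on `H(𝔻)` whose inverse is bounded on discs is invertible. -/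
theorem isUnit_and_inverse_bound {A : HolDisc →L[ℂ] HolDisc} (hinj : Function.Injective A)
    {C : ℝ → ℝ} (hA : ∀ h : HolDisc, ∃ f : HolDisc, A f = h ∧ ∀ r ∈ Ioo (0 : ℝ) 1, ∀ M : ℝ,
      (∀ z, ‖z‖ < r → ‖discFun h z‖ ≤ M) → ∀ z, ‖z‖ < r → ‖discFun f z‖ ≤ C r * M) :
    IsUnit A ∧ ∀ h : HolDisc, ∀ r ∈ Ioo (0 : ℝ) 1, ∀ M : ℝ,
      (∀ z, ‖z‖ < r → ‖discFun h z‖ ≤ M) →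
        ∀ z, ‖z‖ < r → ‖discFun (Ring.inverse A h) z‖ ≤ C r * M := by
  choose S hS hSb using hA
  let e : HolDisc ≃ₗ[ℂ] HolDisc :=
    LinearEquiv.ofBijective A.toLinearMap ⟨hinj, fun g => ⟨S g, hS g⟩⟩
  have he (h : HolDisc) : e.symm h = S h :=
    e.symm_apply_eq.2 (hS h).symm
  have hcont : Continuous e.symm := by
    refine continuous_of_continuousAt_zero e.symm ?_
    rw [ContinuousAt, map_zero]
    intro V hV
    obtain ⟨W, hW, hWV⟩ := exists_nhds_zero_forall_mem (C := C) hV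
    exact mem_map.2 (mem_of_superset hW fun h hh => hWV _ h hh (he h ▸ hSb h))
  let E : HolDisc ≃L[ℂ] HolDisc :=
    { e with
      continuous_toFun := A.cont
      continuous_invFun := hcont }
  have hunit : IsUnit A := ⟨ContinuousLinearEquiv.toUnit E, ContinuousLinearMap.ext fun _ => rfl⟩
  refine ⟨hunit, fun h => ?_⟩
  have h1 : A (Ring.inverse A h) = h := by
    rw [← mul_apply_eq_comp, Ring.mul_inverse_cancel _ hunit,
      one_apply_eq_self]
  rw [hinj (h1.trans (hS h).symm)]
  exact hSb h

/-! ### The spectra -/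

section Cesaro

variable {t : ℝ} (ht : t ∈ Ico (0 : ℝ) 1)

theorem injective_smul_sub_cesaro {μ : ℂ} (hμ : μ ∉ range fun n : ℕ => 1 / ((n : ℂ) + 1)) :
    Function.Injective fun f : HolDisc => μ • f - cesaro t ht f := by
  intro f g hfg
  refine sub_eq_zero.1 (eq_zero_of_smul_eq_cesaro ht hμ ?_)
  rw [smul_sub, map_sub]
  rwa [sub_eq_sub_iff_sub_eq_sub] at hfg

theorem range_subset_pointSpectrum_cesaro :
    (range fun n : ℕ => 1 / ((n : ℂ) + 1)) ⊆ pointSpectrum (cesaro t ht) := by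
  rintro _ ⟨n, rfl⟩ hinj
  refine cesaroEigen_ne_zero ht n (hinj ?_)
  simp only [cesaro_cesaroEigen, sub_self, smul_zero, map_zero]

theorem pointSpectrum_subset_spectrum (T : HolDisc →L[ℂ] HolDisc) :
    pointSpectrum T ⊆ spectrum ℂ T := by
  intro μ hμ hu
  refine hμ ?_
  obtain ⟨B, hB⟩ := isUnit_iff_exists.1 hu
  refine Function.LeftInverse.injective (g := B) fun f => ?_
  exact DFunLike.congr_fun hB.2 f

/-- `Λ ∪ {0}` is closed, being a convergent sequence with its limit, so a whole ball around `μ`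
stays at distance `δ / 2` from it. The distance to `0` bounds `‖ν‖` below, and the distance to `Λ`
controls the small divisors. -/
theorem mem_waelbroeckResolventSet_cesaro {μ : ℂ}
    (hμ : μ ∉ (range fun n : ℕ => 1 / ((n : ℂ) + 1)) ∪ {0}) :
    μ ∈ waelbroeckResolventSet (cesaro t ht) := by
  have hlim : Tendsto (fun n : ℕ => 1 / ((n : ℂ) + 1)) atTop (𝓝 0) :=
    tendsto_one_div_add_atTop_nhds_zero_nat
  have hclosed := hlim.isCompact_insert_range.isClosed
  rw [union_singleton] at hμ
  obtain ⟨δ, hδ, hδμ⟩ := Metric.isOpen_iff.1 hclosed.isOpen_compl μ hμ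
  have hdist {ν x : ℂ} (hν : ν ∈ ball μ (δ / 2))
      (hx : x ∈ insert 0 (range fun n : ℕ => 1 / ((n : ℂ) + 1))) : δ / 2 ≤ ‖ν - x‖ := by
    by_contra! hlt
    refine hδμ ?_ hx
    rw [mem_ball, ← dist_eq_norm] at *
    linarith [dist_triangle x ν μ, dist_comm x ν]
  have hδ2 : 0 < δ / 2 := half_pos hδ
  obtain ⟨C, hC⟩ := cesaroSolvable_zero ht (U := ball μ (δ / 2)) hδ2 hδ2
    (fun ν hν => by simpa using hdist hν (mem_insert _ _))
    (fun ν hν n => hdist hν (mem_insert_of_mem _ ⟨n, rfl⟩))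
  have key (ν : ℂ) (hν : ν ∈ ball μ (δ / 2)) :=
    isUnit_and_inverse_bound (A := algebraMap ℂ (HolDisc →L[ℂ] HolDisc) ν - cesaro t ht) (C := C)
      (injective_smul_sub_cesaro ht fun hmem => by
        have := hdist hν (mem_insert_of_mem _ hmem)
        rw [sub_self, norm_zero] at this
        exact hδ2.not_ge this)
      fun h => hC ν hν h (discFun h) (differentiableOn_discFun h) fun z _ => by
        rw [pow_zero, one_mul]
  refine ⟨δ / 2, hδ2, fun ν hν => (key ν hν).1, ?_⟩
  let _ : UniformSpace HolDisc := IsTopologicalAddGroup.rightUniformSpace HolDisc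
  intro f₀ V hV
  obtain ⟨V', hV', hVV⟩ := mem_comap.1 hV
  -- `W` depends on `C` and `V'` alone, so it serves every `ν` in the ball; linearity moves the
  -- estimate from `0` to `f₀`.
  obtain ⟨W, hW, hWV⟩ := exists_nhds_zero_forall_mem (C := C) hV'
  have hW' : ∀ᶠ f in 𝓝 f₀, f - f₀ ∈ W := by
    have : Tendsto (fun f : HolDisc => f - f₀) (𝓝 f₀) (𝓝 0) := by
      simpa using (continuous_sub_right f₀).tendsto f₀
    exact this hW
  filter_upwards [hW'] with f hf ν
  refine hVV ?_
  have := hWV _ _ hf ((key ν ν.2).2 (f - f₀))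
  rw [map_sub] at this
  simpa [resolvent, sub_eq_add_neg] using this

theorem spectrum_cesaro_subset :
    spectrum ℂ (cesaro t ht) ⊆ range fun n : ℕ => 1 / ((n : ℂ) + 1) := by
  intro μ hμ
  by_contra hn
  by_cases h0 : μ = 0
  · rw [h0, spectrum.zero_mem_iff] at hμ
    exact hμ (isUnit_cesaro ht)
  · obtain ⟨δ, hδ, hsub, -⟩ := mem_waelbroeckResolventSet_cesaro ht (μ := μ) (by simp_all)
    exact hμ (hsub (mem_ball_self hδ))

end Cesaro

theorem mainTheorem4 (t : ℝ) (ht : t ∈ Set.Ico (0 : ℝ) 1) :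
    pointSpectrum (cesaro t ht) = Set.range (fun n : ℕ => 1 / ((n : ℂ) + 1)) ∧
    spectrum ℂ (cesaro t ht) = Set.range (fun n : ℕ => 1 / ((n : ℂ) + 1)) ∧
    waelbroeckSpectrum (cesaro t ht) =
      Set.range (fun n : ℕ => 1 / ((n : ℂ) + 1)) ∪ {0} := by
  have h1 := range_subset_pointSpectrum_cesaro ht
  have h2 := pointSpectrum_subset_spectrum (cesaro t ht)
  have h3 := spectrum_cesaro_subset ht
  refine ⟨(h2.trans h3).antisymm h1, h3.antisymm (h1.trans h2), ?_⟩
  refine Subset.antisymm (fun μ hμ => ?_) (fun μ hμ hρ => ?_)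
  · by_contra hn
    exact hμ (mem_waelbroeckResolventSet_cesaro ht hn)
  · obtain ⟨δ, hδ, hsub, -⟩ := hρ
    rcases hμ with hμ | rfl
    · exact h2 (h1 hμ) (hsub (mem_ball_self hδ))
    -- Although `C_t` is invertible, every disc around `0` contains an eigenvalue.
    · have hlim : Tendsto (fun n : ℕ => 1 / ((n : ℂ) + 1)) atTop (𝓝 0) :=
        tendsto_one_div_add_atTop_nhds_zero_nat
      obtain ⟨n, hn⟩ := (hlim.eventually (ball_mem_nhds 0 hδ)).exists
      exact h2 (h1 ⟨n, rfl⟩) (hsub hn)
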